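/- Let $V_w\in\mathbb{R}^{n_v\times n_x}$ be such that the polytope $\mathbb{W}=\{w\in\mathbb{R}^{n_x}\mid V_w w\le \mathbf{1}\}$ is compact (vector inequalities are componentwise). Let $\Pr$ be a probability distribution on $\mathbb{R}^{n_x}$ with support $\mathbb{W}_{\rm true}\subseteq\mathbb{W}$. Let $\mathcal{I}_0=(w^1,\dots,w^N)$ be a collection of $|\mathcal{I}_0|=N$ offline disturbance samples (counted with multiplicity), i.i.d. with law $\Pr$, and let the online disturbances $w_0,w_1,\dots$ be i.i.d. with law $\Pr$. For $v\in\mathbb{R}^{n_x}$, $\boldsymbol\theta\in\mathbb{R}^{n_v}$, $\rho\in\mathbb{R}$ put $\mathcal{W}(v,\boldsymbol\theta,\rho)=\{w\mid V_w w\le\boldsymbol\theta\}\oplus(1-\rho)v$. Call $(v,\boldsymbol\theta,\rho)$ admissible if $V_w v\le\mathbf{1}$, $\boldsymbol\theta\in[0,1]^{n_v}$, $\rho\in[0,1]$ and $\boldsymbol\theta\le\rho\mathbf{1}$. Let $(v_0^*,\boldsymbol\theta_0^*,\rho_0^*)$ be a minimiser of $\mathbf{1}^T\boldsymbol\theta+\rho$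 over the admissible $(v,\boldsymbol\theta,\rho)$ with $V_w w^s\le\boldsymbol\theta+(1-\rho)V_w v$ for all $s=1,\dots,N$. For $k\ge1$ let $(v_k^*,\boldsymbol\theta_k^*,\rho_k^*)$ be a minimiser of $\mathbf{1}^T\boldsymbol\theta+\rho$ over the admissible $(v,\boldsymbol\theta,\rho)$ with $$\boldsymbol\theta_{k-1}^*+(1-\rho_{k-1}^*)V_w v_{k-1}^*\le\boldsymbol\theta+(1-\rho)V_w v,\qquad V_w w_{k-1}\le\boldsymbol\theta+(1-\rho)V_w v .$$ The learned disturbance sets are $\hat{\mathbb{W}}_k=\mathcal{W}(v_k^*,\boldsymbol\theta_k^*,\rho_k^*)$, $k\in\mathbb{N}=\{0,1,2,\dots\}$. Let $\epsilon,\delta\in(0,1)$ and $$|\mathcal{I}_0|\ \ge\ \frac1\epsilon\,\frac{\mathrm{e}}{\mathrm{e}-1}\Big(n_x+n_v+\ln\frac1\delta\Big),$$ where $\mathrm{e}=\exp(1)$. Then, with probability no less than $1-\delta$ over the random samples and disturbances, minimisers as above exist at every step and, for every choice of them, $$\Pr[\,w\in\mathbb{W}_{\rm true}: w\notin\hat{\mathbb{W}}_k\,]\le\epsilon\qquad\text{for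 all }k\in\mathbb{N}.$$ -/

import Mathlib

open MeasureTheory ProbabilityTheory Matrix
open scoped Pointwise

/-- The polytope `{w ∈ ℝ^{n_x} | V w ≤ θ}` (componentwise order): the heterogeneous scaling of the
base polytope by `θ`. -/
def scaledPolytope {nx nv : ℕ} (V : Matrix (Fin nv) (Fin nx) ℝ) (θ : Fin nv → ℝ) :
    Set (Fin nx → ℝ) :=
  {w | V *ᵥ w ≤ θ}

/-- The base polytope `𝕎 = {w ∈ ℝ^{n_x} | V w ≤ 1}`. -/
def basePolytope {nx nv : ℕ} (V : Matrix (Fin nv) (Fin nx) ℝ) : Set (Fin nx → ℝ) :=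
  scaledPolytope V 1

/-- Design parameters `(v, θ, ρ)` of a parameterised disturbance set. -/
structure ShapeParam (nx nv : ℕ) where
  v : Fin nx → ℝ
  θ : Fin nv → ℝ
  ρ : ℝ

namespace ShapeParam

variable {nx nv : ℕ}

/-- The parameterised set `𝒲(v, θ, ρ) = {w | V w ≤ θ} ⊕ (1 - ρ) v` (Minkowski sum). -/
def toSet (V : Matrix (Fin nv) (Fin nx) ℝ) (p : ShapeParam nx nv) : Set (Fin nx → ℝ) :=
  scaledPolytope V p.θ + {(1 - p.ρ) • p.v}

/-- The vector `θ + (1 - ρ) V v`. -/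
def bound (V : Matrix (Fin nv) (Fin nx) ℝ) (p : ShapeParam nx nv) : Fin nv → ℝ :=
  p.θ + (1 - p.ρ) • (V *ᵥ p.v)

/-- The constraints on the design parameters that do not involve data:
`V v ≤ 1`, `θ ∈ [0,1]^{n_v}`, `ρ ∈ [0,1]`, `θ ≤ ρ 1`. -/
def Admissible (V : Matrix (Fin nv) (Fin nx) ℝ) (p : ShapeParam nx nv) : Prop :=
  V *ᵥ p.v ≤ 1 ∧ p.θ ∈ Set.Icc 0 1 ∧ p.ρ ∈ Set.Icc (0 : ℝ) 1 ∧ p.θ ≤ p.ρ • 1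

/-- The objective `1ᵀ θ + ρ`. -/
def cost (p : ShapeParam nx nv) : ℝ := (∑ i, p.θ i) + p.ρ

/-- Feasible set of the initial problem, with offline samples `ws`. -/
def initFeasible {N : ℕ} (V : Matrix (Fin nv) (Fin nx) ℝ) (ws : Fin N → Fin nx → ℝ) :
    Set (ShapeParam nx nv) :=
  {p | p.Admissible V ∧ ∀ s, V *ᵥ ws s ≤ p.bound V}

/-- Feasible set of the online update, with previous parameters `q` and newly observed
disturbance `w`. -/
def updateFeasible (V : Matrix (Fin nv) (Fin nx) ℝ) (q : ShapeParam nx nv) (w : Fin nx → ℝ) :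
    Set (ShapeParam nx nv) :=
  {p | p.Admissible V ∧ q.bound V ≤ p.bound V ∧ V *ᵥ w ≤ p.bound V}

/-- `p` minimises the objective over the feasible set `S`. -/
def IsArgmin (S : Set (ShapeParam nx nv)) (p : ShapeParam nx nv) : Prop :=
  p ∈ S ∧ ∀ q ∈ S, p.cost ≤ q.cost

/-- `p 0, p 1, …` is a sequence of parameters produced by the learning scheme from the offline
samples `ws` and the online disturbances `w 0, w 1, …`: `p 0` is an optimiser of the initial
problem, and `p (k + 1)` is an optimiser of the update problem that uses `p k` and `w k`. -/
def IsLearned {N : ℕ} (V : Matrix (Fin nv) (Fin nx) ℝ) (ws : Fin N → Fin nx → ℝ)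
    (w : ℕ → Fin nx → ℝ) (p : ℕ → ShapeParam nx nv) : Prop :=
  IsArgmin (initFeasible V ws) (p 0) ∧
    ∀ k, IsArgmin (updateFeasible V (p k) (w k)) (p (k + 1))

end ShapeParam

/-! ### Combinatorics of coordinatewise maxima. -/

section ScoreMaxima

open scoped ENNReal

variable {α ι J : Type*} [LinearOrder J]

/-! The vectors `bound` increase along the learning scheme, so a point outside any learned set beats
all offline samples in some facet direction. One event about `nv` maxima of `N` samples therefore
controls every step, with no union bound over time.

A union bound over the selections `s` of maximising indices would cost a power of `N`. Instead, keep
each index independently with weight `p`: a given subset admits at most one selection, so the total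
weight of all selections is at most 1 (`sum_prod_dominated_le_one`). For fixed `s`, passing from the
full sample to the thinned one costs `p⁻¹` per selected index and gains `κ` per other index, which
on the bad event is dominated with probability at most `1 - ε` (`lintegral_prod_dominated_le`).
Summing over `s` bounds the bad event by `p⁻¹ ^ d * κ ^ (N - d)` with `d = nv`; taking `p = d / (N
ε)` yields the factor `e / (e - 1)`. -/

/-- The points whose scores `f i` are at most the levels `t i`; a point with index `j` may attain
the level `t i` only if `j ≤ s i`. -/
def dominated (f : ι → α → ℝ) (s : ι → J) (t : ι → ℝ) (j : J) : Set α :=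
  {y | ∀ i, f i y < t i ∨ f i y = t i ∧ j ≤ s i}

/-- The points that exceed one of the levels `t i`. -/
def exceeding (f : ι → α → ℝ) (t : ι → ℝ) : Set α :=
  {y | ∃ i, t i < f i y}

theorem dominated_subset_compl_exceeding (f : ι → α → ℝ) (s : ι → J) (t : ι → ℝ) (j : J) :
    dominated f s t j ⊆ (exceeding f t)ᶜ := by
  rintro y hy ⟨i, hi⟩
  rcases hy i with h | h
  · exact lt_asymm h hi
  · exact hi.ne' h.1

/-- Each selection dominates the points selected by the other, so scores agree; the index tie-break
then forces equal indices. -/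
theorem eq_of_mem_dominated (f : ι → α → ℝ) (x : J → α) (T : Finset J) {s s' : ι → J}
    (hs : ∀ i, s i ∈ T) (hs' : ∀ i, s' i ∈ T)
    (h : ∀ j ∈ T, x j ∈ dominated f s (fun i => f i (x (s i))) j)
    (h' : ∀ j ∈ T, x j ∈ dominated f s' (fun i => f i (x (s' i))) j) : s = s' := by
  funext i
  have h1 := h _ (hs' i) i
  have h2 := h' _ (hs i) i
  grind

theorem exists_mem_dominated [Finite J] [Nonempty J] (f : ι → α → ℝ) (x : J → α) :
    ∃ s : ι → J, ∀ j, x j ∈ dominated f s (fun i => f i (x (s i))) j := by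
  have h : ∀ i, ∃ k : J, ∀ j, toLex (f i (x j), j) ≤ toLex (f i (x k), k) := fun i =>
    Finite.exists_max fun j => toLex (f i (x j), j)
  choose s hs using h
  exact ⟨s, fun j i => by simpa [Prod.Lex.toLex_le_toLex] using hs i j⟩

variable [Fintype ι]

open scoped Classical in
/-- A random subset that keeps each index with weight `p` has at most one selection of maximisers. -/
theorem sum_prod_dominated_le_one [Fintype J] (f : ι → α → ℝ) (x : J → α) {p q : ℝ≥0∞} (hpq : p + q = 1) :
    ∑ s : ι → J, ∏ j, (p * (dominated f s (fun i => f i (x (s i))) j).indicator 1 (x j) +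
      if j ∈ Set.range s then 0 else q) ≤ 1 := by
  -- In the expanded product `T` is the kept subset: the zeros force `s` to select from `T`, and the
  -- indicators make it maximal there.
  have hsel : ∀ (T : Finset J) (s : ι → J),
      (∏ j ∈ T, p * (dominated f s (fun i => f i (x (s i))) j).indicator 1 (x j)) *
        ∏ j ∈ Finset.univ \ T, (if j ∈ Set.range s then 0 else q) ≠ 0 →
      (∀ i, s i ∈ T) ∧ ∀ j ∈ T, x j ∈ dominated f s (fun i => f i (x (s i))) j := by
    intro T s hz
    rw [mul_ne_zero_iff, Finset.prod_ne_zero_iff, Finset.prod_ne_zero_iff] at hz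
    refine ⟨fun i => ?_, fun j hj => ?_⟩ <;> by_contra hi
    · exact hz.2 (s i) (by simpa using hi) (by simp)
    · exact hz.1 j hj (by simp [hi])
  simp_rw [Finset.prod_add]
  rw [Finset.sum_comm]
  calc _ ≤ ∑ T : Finset J, p ^ T.card * q ^ (Fintype.card J - T.card) := by
        rw [Finset.powerset_univ]
        refine Finset.sum_le_sum fun T _ => ?_
        by_cases hT : ∃ s : ι → J, (∀ i, s i ∈ T) ∧
            ∀ j ∈ T, x j ∈ dominated f s (fun i => f i (x (s i))) j
        · obtain ⟨s, hs, hd⟩ := hT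
          rw [Finset.sum_eq_single s]
          · refine mul_le_mul' ?_ ?_
            · refine (Finset.prod_le_pow_card _ _ p fun j _ => ?_)
              refine mul_le_of_le_one_right' ?_
              exact Set.indicator_le_self' (by simp) _
            · rw [← Finset.card_univ, ← Finset.card_sdiff_of_subset T.subset_univ]
              refine Finset.prod_le_pow_card _ _ q fun j _ => ?_
              split_ifs <;> simp
          · intro s' _ hne
            by_contra hz
            obtain ⟨h1, h2⟩ := hsel T s' hz
            exact hne (eq_of_mem_dominated f x T h1 hs h2 hd)
          · simp
        · rw [Finset.sum_eq_zero]
          · exact zero_le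
          · intro s' _
            by_contra hz
            exact hT ⟨s', hsel T s' hz⟩
    _ = 1 := by
        rw [Fintype.sum_pow_mul_eq_add_pow, hpq, one_pow]

/-! ### Measurability and the probabilistic estimate. -/

variable [MeasurableSpace α]

theorem measurableSet_dominated {f : ι → α → ℝ} (hf : ∀ i, Measurable (f i)) (s : ι → J) (j : J) :
    MeasurableSet {z : (ι → ℝ) × α | z.2 ∈ dominated f s z.1 j} := by
  have h : {z : (ι → ℝ) × α | z.2 ∈ dominated f s z.1 j} =
      ⋂ i, {z | f i z.2 < z.1 i ∨ f i z.2 = z.1 i ∧ j ≤ s i} := by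
    ext z
    simp [dominated]
  rw [h]
  refine MeasurableSet.iInter fun i => ?_
  have h1 : Measurable fun z : (ι → ℝ) × α => f i z.2 := (hf i).comp measurable_snd
  have h2 : Measurable fun z : (ι → ℝ) × α => z.1 i := (measurable_pi_apply i).comp measurable_fst
  exact (measurableSet_lt h1 h2).union ((measurableSet_eq_fun h1 h2).inter (.const _))

theorem measurableSet_exceeding {f : ι → α → ℝ} (hf : ∀ i, Measurable (f i)) :
    MeasurableSet {z : (ι → ℝ) × α | z.2 ∈ exceeding f z.1} := by
  have h : {z : (ι → ℝ) × α | z.2 ∈ exceeding f z.1} = ⋃ i, {z | z.1 i < f i z.2} := by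
    ext z
    simp [exceeding]
  rw [h]
  refine MeasurableSet.iUnion fun i => ?_
  exact measurableSet_lt ((measurable_pi_apply i).comp measurable_fst) ((hf i).comp measurable_snd)

theorem measurable_indicator_dominated {f : ι → α → ℝ} (hf : ∀ i, Measurable (f i)) (s : ι → J)
    (j : J) : Measurable fun x : J → α =>
      (dominated f s (fun i => f i (x (s i))) j).indicator (1 : α → ℝ≥0∞) (x j) := by
  have h : Measurable fun x : J → α => ((fun i => f i (x (s i))), x j) := by
    refine Measurable.prodMk (measurable_pi_lambda _ fun i => ?_) (measurable_pi_apply j)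
    exact (hf i).comp (measurable_pi_apply _)
  exact (measurable_const (a := (1 : ℝ≥0∞))).indicator (h (measurableSet_dominated hf s j))

theorem measurableSet_lt_measure_exceeding {f : ι → α → ℝ} (hf : ∀ i, Measurable (f i))
    (μ : Measure α) [SFinite μ] (ε : ℝ≥0∞) :
    MeasurableSet {t : ι → ℝ | ε < μ (exceeding f t)} :=
  measurableSet_lt measurable_const (measurable_measure_prodMk_left (measurableSet_exceeding hf))

variable [Fintype J]

/-- Integrating a product of functions of single coordinates over the coordinates in `S`. -/
theorem lintegral_prod_updateFinset (μ : Measure α) [IsProbabilityMeasure μ]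
    (S : Finset J) (φ : J → α → ℝ≥0∞) (hφ : ∀ j, Measurable (φ j)) (x : J → α) :
    ∫⁻ y : S → α, ∏ j, φ j (Function.updateFinset x S y j) ∂Measure.pi (fun _ => μ) =
      (∏ j ∈ Sᶜ, φ j (x j)) * ∏ j ∈ S, ∫⁻ z, φ j z ∂μ := by
  have h : ∀ y : S → α, ∏ j, φ j (Function.updateFinset x S y j) =
      (∏ j ∈ Sᶜ, φ j (x j)) * ∏ j : S, φ j (y j) := by
    intro y
    rw [← Finset.prod_compl_mul_prod S]
    congr 1
    · refine Finset.prod_congr rfl fun j hj => ?_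
      simp [Function.updateFinset, Finset.mem_compl.1 hj]
    · rw [← Finset.prod_coe_sort S]
      refine Finset.prod_congr rfl fun j _ => ?_
      simp [Function.updateFinset]
  simp_rw [h]
  have hm : ∀ j : S, Measurable fun y : S → α => φ j (y j) := fun j =>
    (hφ j).comp (measurable_pi_apply j)
  rw [lintegral_const_mul _ (Finset.measurable_prod _ fun j _ => hm j)]
  congr 1
  have hi : iIndepFun (fun (j : S) (y : S → α) => φ j (y j)) (Measure.pi fun _ : S => μ) :=
    iIndepFun_pi fun j => (hφ j).aemeasurable
  rw [lintegral_prod_eq_prod_lintegral_of_indepFun _ _ hi hm, ← Finset.prod_coe_sort S]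
  refine Finset.prod_congr rfl fun j _ => ?_
  exact (measurePreserving_eval (fun _ : S => μ) j).lintegral_comp (hφ j)

-- Given the selected samples, the levels are fixed and the other samples are independent, so both
-- integrals factor and can be compared index by index.
open scoped Classical in
theorem lintegral_prod_dominated_le {f : ι → α → ℝ} (hf : ∀ i, Measurable (f i))
    (μ : Measure α) [IsProbabilityMeasure μ] (s : ι → J) {ε p q κ : ℝ≥0∞}
    (hp0 : p ≠ 0) (hp : p ≤ 1) (hκ : κ ≤ 1)
    (h : ∀ g ≤ 1 - ε, g ≤ κ * (p * g + q)) (hc : Fintype.card ι ≤ Fintype.card J) :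
    ∫⁻ x : J → α, {t | ε < μ (exceeding f t)}.indicator 1 (fun i => f i (x (s i))) *
        ∏ j, (dominated f s (fun i => f i (x (s i))) j).indicator (1 : α → ℝ≥0∞) (x j)
          ∂Measure.pi (fun _ => μ) ≤
      p⁻¹ ^ Fintype.card ι * κ ^ (Fintype.card J - Fintype.card ι) *
        ∫⁻ x : J → α, ∏ j, (p * (dominated f s (fun i => f i (x (s i))) j).indicator 1 (x j) +
          if j ∈ Set.range s then 0 else q) ∂Measure.pi (fun _ => μ) := by
  have hpt : p ≠ ∞ := ne_top_of_le_ne_top ENNReal.one_ne_top hp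
  have hp1 : 1 ≤ p⁻¹ := ENNReal.one_le_inv.2 hp
  set K := p⁻¹ ^ Fintype.card ι * κ ^ (Fintype.card J - Fintype.card ι)
  set R : Finset J := Finset.univ.image s with hR
  have hRm : ∀ j, j ∈ Set.range s ↔ j ∈ R := by simp [hR]
  have hRc : R.card ≤ Fintype.card ι := Finset.card_image_le
  -- One sample may attain several maxima, so `R` can have fewer than `card ι` elements; the worst
  -- case is an injective `s`.
  have hK : p⁻¹ ^ R.card * κ ^ Rᶜ.card ≤ K := by
    refine mul_le_mul' (pow_le_pow_right₀ hp1 hRc) (pow_le_pow_right_of_le_one' hκ ?_)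
    rw [Finset.card_compl]
    lia
  have hmG : Measurable fun x : J → α => ∏ j,
      (p * (dominated f s (fun i => f i (x (s i))) j).indicator 1 (x j) +
        if j ∈ Set.range s then 0 else q) :=
    Finset.measurable_prod _ fun j _ =>
      ((measurable_indicator_dominated hf s j).const_mul p).add_const _
  have hmt : Measurable fun (x : J → α) (i : ι) => f i (x (s i)) :=
    measurable_pi_lambda _ fun i => (hf i).comp (measurable_pi_apply _)
  have hmF : Measurable fun x : J → α =>
      {t | ε < μ (exceeding f t)}.indicator 1 (fun i => f i (x (s i))) *
        ∏ j, (dominated f s (fun i => f i (x (s i))) j).indicator (1 : α → ℝ≥0∞) (x j) := by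
    refine Measurable.mul ?_ (Finset.measurable_prod _ fun j _ =>
      measurable_indicator_dominated hf s j)
    exact (measurable_one.indicator (measurableSet_lt_measure_exceeding hf μ ε)).comp hmt
  rw [← lintegral_const_mul _ hmG]
  obtain hJ | hJ := isEmpty_or_nonempty (J → α)
  · simp [Measure.eq_zero_of_isEmpty]
  have x₀ : J → α := Classical.choice hJ
  -- Integrate the unselected coordinates first, with those in `R` frozen.
  have hL : ∀ F : (J → α) → ℝ≥0∞, Measurable F → ∫⁻ x, F x ∂Measure.pi (fun _ => μ) =
      (∫⋯∫⁻_R, ∫⋯∫⁻_Rᶜ, F ∂(fun _ => μ) ∂(fun _ => μ)) x₀ := by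
    intro F hF
    rw [lintegral_eq_lmarginal_univ x₀, ← Finset.union_compl R,
      lmarginal_union _ _ hF disjoint_compl_right]
  rw [hL _ hmF, hL _ (hmG.const_mul K)]
  refine lmarginal_mono (fun x => ?_) x₀
  simp only [lmarginal]
  have hs : ∀ (y : (Rᶜ : Finset J) → α) i, Function.updateFinset x Rᶜ y (s i) = x (s i) := by
    intro y i
    simp [Function.updateFinset, hR]
  simp only [hs]
  set t : ι → ℝ := fun i => f i (x (s i))
  have hmD : ∀ j, MeasurableSet (dominated f s t j) := fun j =>
    measurable_prodMk_left (measurableSet_dominated hf s j)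
  have hmi : ∀ j, Measurable ((dominated f s t j).indicator (1 : α → ℝ≥0∞)) := fun j =>
    measurable_one.indicator (hmD j)
  by_cases ht : ε < μ (exceeding f t)
  swap
  · simp [ht]
  rw [lintegral_const_mul' _ _ (by simp [ht]), lintegral_const_mul _ ?_,
    lintegral_prod_updateFinset μ Rᶜ _ hmi,
    lintegral_prod_updateFinset μ Rᶜ
      (fun j z => p * (dominated f s t j).indicator 1 z + if j ∈ Set.range s then 0 else q)
      (fun j => ((hmi j).const_mul p).add_const _)]
  swap
  · refine Finset.measurable_prod _ fun j _ => Measurable.add_const (Measurable.const_mul ?_ _) _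
    exact (hmi j).comp (measurable_pi_iff.1 (measurable_updateFinset (s := Rᶜ) (x := x)) j)
  simp only [compl_compl, Set.mem_ofPred_eq, ht, Set.indicator_of_mem, Pi.one_apply, one_mul]
  have hg : ∀ j, μ (dominated f s t j) ≤ 1 - ε := by
    intro j
    refine (measure_mono (dominated_subset_compl_exceeding f s t j)).trans ?_
    have hme : MeasurableSet (exceeding f t) :=
      measurable_prodMk_left (measurableSet_exceeding hf)
    rw [prob_compl_eq_one_sub hme]
    exact tsub_le_tsub_left ht.le 1
  have e1 : ∏ j ∈ R, (dominated f s t j).indicator (1 : α → ℝ≥0∞) (x j) =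
      p⁻¹ ^ R.card * ∏ j ∈ R, (p * (dominated f s t j).indicator 1 (x j) +
        if j ∈ Set.range s then 0 else q) := by
    rw [← Finset.prod_const, ← Finset.prod_mul_distrib]
    refine Finset.prod_congr rfl fun j hj => ?_
    rw [if_pos ((hRm j).2 hj), add_zero, ← mul_assoc, ENNReal.inv_mul_cancel hp0 hpt, one_mul]
  have e2 : ∏ j ∈ Rᶜ, ∫⁻ z, (dominated f s t j).indicator 1 z ∂μ ≤
      κ ^ Rᶜ.card * ∏ j ∈ Rᶜ, ∫⁻ z, (p * (dominated f s t j).indicator 1 z +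
        if j ∈ Set.range s then 0 else q) ∂μ := by
    rw [← Finset.prod_const, ← Finset.prod_mul_distrib]
    refine Finset.prod_le_prod' fun j hj => ?_
    rw [if_neg ((hRm j).not.2 (Finset.mem_compl.1 hj)), lintegral_add_right _ measurable_const,
      lintegral_const_mul _ (hmi j), lintegral_indicator_one (hmD j)]
    simpa using h _ (hg j)
  rw [e1]
  refine (mul_le_mul_right e2 _).trans (le_trans (le_of_eq ?_) (mul_le_mul_left hK _))
  ring

open scoped Classical in
/-- The coordinatewise maxima of `card J` independent samples of `card ι` scores: the probability
that a new point exceeds one of them is rarely more than `ε`. -/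
theorem pi_measure_lt_measure_exceeding_le [Nonempty J] {f : ι → α → ℝ}
    (hf : ∀ i, Measurable (f i)) (μ : Measure α) [IsProbabilityMeasure μ] {ε p q κ : ℝ≥0∞}
    (hp0 : p ≠ 0) (hpq : p + q = 1) (hκ : κ ≤ 1)
    (h : ∀ g ≤ 1 - ε, g ≤ κ * (p * g + q)) (hc : Fintype.card ι ≤ Fintype.card J) :
    Measure.pi (fun _ : J => μ) {x | ε < μ {y | ∃ i, ∀ j, f i (x j) < f i y}} ≤
      p⁻¹ ^ Fintype.card ι * κ ^ (Fintype.card J - Fintype.card ι) := by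
  have hp : p ≤ 1 := hpq ▸ le_self_add
  set K := p⁻¹ ^ Fintype.card ι * κ ^ (Fintype.card J - Fintype.card ι)
  have hmG : ∀ s : ι → J, Measurable fun x : J → α => ∏ j,
      (p * (dominated f s (fun i => f i (x (s i))) j).indicator 1 (x j) +
        if j ∈ Set.range s then 0 else q) := fun s =>
    Finset.measurable_prod _ fun j _ =>
      ((measurable_indicator_dominated hf s j).const_mul p).add_const _
  have hmF : ∀ s : ι → J, Measurable fun x : J → α =>
      {t | ε < μ (exceeding f t)}.indicator 1 (fun i => f i (x (s i))) *
        ∏ j, (dominated f s (fun i => f i (x (s i))) j).indicator (1 : α → ℝ≥0∞) (x j) := by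
    intro s
    refine Measurable.mul ?_ (Finset.measurable_prod _ fun j _ =>
      measurable_indicator_dominated hf s j)
    exact (measurable_one.indicator (measurableSet_lt_measure_exceeding hf μ ε)).comp
      (measurable_pi_lambda _ fun i => (hf i).comp (measurable_pi_apply _))
  calc _ ≤ ∫⁻ x : J → α, ∑ s : ι → J,
        {t | ε < μ (exceeding f t)}.indicator 1 (fun i => f i (x (s i))) *
        ∏ j, (dominated f s (fun i => f i (x (s i))) j).indicator (1 : α → ℝ≥0∞) (x j)
          ∂Measure.pi (fun _ => μ) := by
        refine meas_le_lintegral₀ (Finset.measurable_sum _ fun s _ => hmF s).aemeasurable ?_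
        intro x hx
        obtain ⟨s, hs⟩ := exists_mem_dominated f x
        refine le_trans ?_ (Finset.single_le_sum (fun _ _ => zero_le) (Finset.mem_univ s))
        have hx' : ε < μ (exceeding f fun i => f i (x (s i))) := by
          refine lt_of_lt_of_le hx (measure_mono ?_)
          rintro y ⟨i, hi⟩
          exact ⟨i, hi _⟩
        simp [hx', hs]
    _ ≤ ∑ s : ι → J, K * ∫⁻ x : J → α, ∏ j,
        (p * (dominated f s (fun i => f i (x (s i))) j).indicator 1 (x j) +
          if j ∈ Set.range s then 0 else q) ∂Measure.pi (fun _ => μ) := by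
        rw [lintegral_finsetSum _ fun s _ => hmF s]
        exact Finset.sum_le_sum fun s _ => lintegral_prod_dominated_le hf μ s hp0 hp hκ h hc
    _ = K * ∫⁻ x : J → α, ∑ s : ι → J, ∏ j,
        (p * (dominated f s (fun i => f i (x (s i))) j).indicator 1 (x j) +
          if j ∈ Set.range s then 0 else q) ∂Measure.pi (fun _ => μ) := by
        rw [lintegral_finsetSum _ fun s _ => hmG s, Finset.mul_sum]
    _ ≤ K * ∫⁻ _ : J → α, 1 ∂Measure.pi (fun _ => μ) := by
        gcongr with x
        exact sum_prod_dominated_le_one f x hpq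
    _ = K := by simp

/-- Chernoff-type form of `pi_measure_lt_measure_exceeding_le`. -/
theorem pi_measure_lt_measure_exceeding_le_exp {f : ι → α → ℝ}
    (hf : ∀ i, Measurable (f i)) (μ : Measure α) [IsProbabilityMeasure μ] {ε : ℝ}
    (hε : ε ∈ Set.Ioo (0 : ℝ) 1) (hc : (Fintype.card ι : ℝ) < Fintype.card J * ε) :
    Measure.pi (fun _ : J => μ) {x | ε < μ.real {y | ∃ i, ∀ j, f i (x j) < f i y}} ≤
      ENNReal.ofReal (Real.exp (Fintype.card ι - Fintype.card J * ε * (1 - (Real.exp 1)⁻¹))) := by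
  obtain ⟨hε0, hε1⟩ := hε
  set d := Fintype.card ι
  set N := Fintype.card J with hNdef
  obtain hι | hι := isEmpty_or_nonempty ι
  · simp [hε0.not_gt]
  have hd0 : (0 : ℝ) < d := by exact_mod_cast Fintype.card_pos
  have hNε : 0 < N * ε := hd0.trans hc
  have hN0 : (0 : ℝ) < N := pos_of_mul_pos_left hNε hε0.le
  have hdN : (d : ℝ) < N := hc.trans (mul_lt_of_lt_one_right hN0 hε1)
  have hJ : Nonempty J := Fintype.card_pos_iff.1 (by exact_mod_cast hN0)
  -- With this `p`, `1 - p * ε = (N - d) / N`, hence `(N - d) * κ = N * (1 - ε)`.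
  set p : ℝ := d / (N * ε) with hp
  have hp0 : 0 < p := div_pos hd0 hNε
  have hp1 : p < 1 := (div_lt_one hNε).2 hc
  have hpε : p * ε = d / N := by rw [hp]; field_simp
  have hpε1 : 0 < 1 - p * ε := by nlinarith
  set κ : ℝ := (1 - ε) / (1 - p * ε) with hκ
  have hκ0 : 0 ≤ κ := div_nonneg (by linarith) hpε1.le
  have hκ1 : κ ≤ 1 := (div_le_one hpε1).2 (by nlinarith)
  have key := pi_measure_lt_measure_exceeding_le (J := J) hf μ (ε := ENNReal.ofReal ε)
    (p := ENNReal.ofReal p) (q := ENNReal.ofReal (1 - p)) (κ := ENNReal.ofReal κ)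
    (by simpa using hp0) (by rw [← ENNReal.ofReal_add hp0.le (by linarith)]; simp)
    (by simpa using hκ1) ?_ (by exact_mod_cast hdN.le)
  · refine (measure_mono ?_).trans (key.trans ?_)
    · intro x hx
      exact (ENNReal.ofReal_lt_iff_lt_toReal hε0.le (measure_ne_top _ _)).2 hx
    · rw [← ENNReal.ofReal_inv_of_pos hp0, ← ENNReal.ofReal_pow (by positivity),
        ← ENNReal.ofReal_pow hκ0, ← ENNReal.ofReal_mul (by positivity)]
      refine ENNReal.ofReal_le_ofReal ?_
      have hle : d ≤ N := by exact_mod_cast hdN.le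
      -- Write `p⁻¹ = e * y` and use `y ≤ exp (y - 1)`; the `d`-th power is then at most `exp (N ε /
      -- e)`.
      have a1 : p⁻¹ ≤ Real.exp (1 + (N * ε / (d * Real.exp 1) - 1)) := by
        rw [Real.exp_add]
        calc p⁻¹ = Real.exp 1 * (N * ε / (d * Real.exp 1)) := by rw [hp]; field_simp
          _ ≤ _ := by
            gcongr
            linarith [Real.add_one_le_exp (N * ε / (d * Real.exp 1) - 1)]
      have a2 : κ ≤ Real.exp (κ - 1) := by linarith [Real.add_one_le_exp (κ - 1)]
      have hκN : ((N : ℝ) - d) * κ = N * (1 - ε) := by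
        rw [hκ, hpε]
        have : (N : ℝ) - d ≠ 0 := by linarith
        field_simp
      calc p⁻¹ ^ d * κ ^ (N - d)
          ≤ Real.exp (1 + (N * ε / (d * Real.exp 1) - 1)) ^ d * Real.exp (κ - 1) ^ (N - d) := by
            gcongr
        _ = Real.exp (d * (1 + (N * ε / (d * Real.exp 1) - 1)) + (N - d : ℕ) * (κ - 1)) := by
            rw [← Real.exp_nat_mul, ← Real.exp_nat_mul, ← Real.exp_add]
        _ = _ := by
            congr 1
            rw [Nat.cast_sub hle, mul_sub (N - d : ℝ), hκN]
            field_simp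
            ring
  · intro g hg
    have hgt : g ≠ ⊤ := ne_top_of_le_ne_top ENNReal.one_ne_top (hg.trans tsub_le_self)
    lift g to NNReal using hgt
    rw [← ENNReal.ofReal_one, ← ENNReal.ofReal_sub _ hε0.le, ← ENNReal.ofReal_coe_nnreal,
      ENNReal.ofReal_le_ofReal_iff (by linarith)] at hg
    rw [← ENNReal.ofReal_coe_nnreal, ← ENNReal.ofReal_mul hp0.le,
      ← ENNReal.ofReal_add (by positivity) (by linarith), ← ENNReal.ofReal_mul hκ0]
    refine ENNReal.ofReal_le_ofReal ?_
    -- The ratio `g / (p g + 1 - p)` increases in `g` and equals `κ` at `g = 1 - ε`.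
    rw [hκ, div_mul_eq_mul_div, le_div_iff₀ hpε1]
    nlinarith [mul_nonneg (sub_nonneg.2 hg) (sub_nonneg.2 hp1.le)]

end ScoreMaxima
-- The learning scheme: existence of minimisers and monotonicity.
namespace ShapeParam

variable {nx nv : ℕ} {V : Matrix (Fin nv) (Fin nx) ℝ}

theorem mem_toSet_of_le_bound {p : ShapeParam nx nv} {x : Fin nx → ℝ} (h : V *ᵥ x ≤ p.bound V) :
    x ∈ p.toSet V := by
  refine Set.mem_add.2 ⟨x - (1 - p.ρ) • p.v, ?_, _, rfl, sub_add_cancel _ _⟩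
  change V *ᵥ (x - (1 - p.ρ) • p.v) ≤ p.θ
  rw [mulVec_sub, mulVec_smul]
  exact sub_le_iff_le_add.2 h

theorem Admissible.bound_le_one {p : ShapeParam nx nv} (hp : p.Admissible V) : p.bound V ≤ 1 := by
  obtain ⟨h1, -, h3, h4⟩ := hp
  intro i
  have h1i := h1 i
  have h4i := h4 i
  simp only [bound, Pi.add_apply, Pi.smul_apply, Pi.one_apply, smul_eq_mul, mul_one] at *
  nlinarith [mul_le_mul_of_nonneg_left h1i (sub_nonneg.2 h3.2)]

theorem exists_isArgmin_of_le_one (hW : IsCompact (basePolytope V)) {κ : Type*}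
    (b : κ → Fin nv → ℝ) (hb : ∀ a, b a ≤ 1) :
    ∃ p, IsArgmin {p : ShapeParam nx nv | p.Admissible V ∧ ∀ a, b a ≤ p.bound V} p := by
  let ofTriple : (Fin nx → ℝ) × (Fin nv → ℝ) × ℝ → ShapeParam nx nv := fun t => ⟨t.1, t.2.1, t.2.2⟩
  let S : Set ((Fin nx → ℝ) × (Fin nv → ℝ) × ℝ) :=
    {t | (ofTriple t).Admissible V ∧ ∀ a, b a ≤ (ofTriple t).bound V}
  have hsub : S ⊆ basePolytope V ×ˢ Set.Icc 0 1 ×ˢ Set.Icc 0 1 := fun t ht =>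
    ⟨ht.1.1, ht.1.2.1, ht.1.2.2.1⟩
  have hV : Continuous fun t : (Fin nx → ℝ) × (Fin nv → ℝ) × ℝ => V *ᵥ t.1 :=
    Continuous.matrix_mulVec continuous_const continuous_fst
  have hclosed : IsClosed S := by
    refine IsClosed.inter (IsClosed.inter ?_ (IsClosed.inter ?_ (IsClosed.inter ?_ ?_))) ?_
    · exact isClosed_le hV continuous_const
    · exact isClosed_Icc.preimage (by fun_prop : Continuous
        fun t : (Fin nx → ℝ) × (Fin nv → ℝ) × ℝ => t.2.1)
    · exact isClosed_Icc.preimage (by fun_prop : Continuous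
        fun t : (Fin nx → ℝ) × (Fin nv → ℝ) × ℝ => t.2.2)
    · change IsClosed {t : (Fin nx → ℝ) × (Fin nv → ℝ) × ℝ | t.2.1 ≤ t.2.2 • (1 : Fin nv → ℝ)}
      exact isClosed_le (by fun_prop) (by fun_prop)
    · change IsClosed {t : (Fin nx → ℝ) × (Fin nv → ℝ) × ℝ |
        ∀ a, b a ≤ t.2.1 + (1 - t.2.2) • (V *ᵥ t.1)}
      rw [Set.ofPred_forall]
      exact isClosed_iInter fun a => isClosed_le continuous_const (by fun_prop)
  have hcompact : IsCompact S :=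
    (hW.prod (isCompact_Icc.prod isCompact_Icc)).of_isClosed_subset hclosed hsub
  have hne : S.Nonempty := by
    -- These parameters describe the base polytope itself, with `bound` equal to 1.
    refine ⟨(0, 1, 1), ⟨?_, ?_, ?_, ?_⟩, fun a => ?_⟩
    · simp [ofTriple]
    · simp [ofTriple]
    · simp [ofTriple]
    · simp [ofTriple]
    · simpa [ofTriple, bound] using hb a
  obtain ⟨t, ht, hmin⟩ := hcompact.exists_isMinOn hne
    (f := fun t => (∑ i, t.2.1 i) + t.2.2) (by fun_prop)
  exact ⟨ofTriple t, ht, fun q hq => hmin (a := (q.v, q.θ, q.ρ)) hq⟩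

theorem exists_isArgmin_initFeasible (hW : IsCompact (basePolytope V)) {N : ℕ}
    {ws : Fin N → Fin nx → ℝ} (hws : ∀ s, ws s ∈ basePolytope V) :
    ∃ p, IsArgmin (initFeasible V ws) p :=
  exists_isArgmin_of_le_one hW (fun s => V *ᵥ ws s) hws

theorem exists_isArgmin_updateFeasible (hW : IsCompact (basePolytope V)) {q : ShapeParam nx nv}
    (hq : q.Admissible V) {w : Fin nx → ℝ} (hw : w ∈ basePolytope V) :
    ∃ p, IsArgmin (updateFeasible V q w) p := by
  have h := exists_isArgmin_of_le_one hW
    (fun a : Bool => bif a then q.bound V else V *ᵥ w)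
    (Bool.forall_bool.2 ⟨hw, hq.bound_le_one⟩)
  simpa [Bool.forall_bool, updateFeasible, and_comm, and_left_comm] using h

theorem exists_isLearned (hW : IsCompact (basePolytope V)) {N : ℕ} {ws : Fin N → Fin nx → ℝ}
    (hws : ∀ s, ws s ∈ basePolytope V) {w : ℕ → Fin nx → ℝ} (hw : ∀ k, w k ∈ basePolytope V) :
    ∃ p, IsLearned V ws w p := by
  obtain ⟨p₀, hp₀⟩ := exists_isArgmin_initFeasible hW hws
  -- Admissibility is carried along because it keeps `bound` below 1, hence the next problem
  -- feasible.
  have hstep : ∀ (k : ℕ) (q : {q : ShapeParam nx nv // q.Admissible V}),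
      ∃ p : {p : ShapeParam nx nv // p.Admissible V}, IsArgmin (updateFeasible V q.1 (w k)) p.1 := by
    intro k q
    obtain ⟨p, hp⟩ := exists_isArgmin_updateFeasible hW q.2 (hw k)
    exact ⟨⟨p, hp.1.1⟩, hp⟩
  choose step hstep using hstep
  let p : ℕ → {p : ShapeParam nx nv // p.Admissible V} :=
    fun k => Nat.rec ⟨p₀, hp₀.1.1⟩ step k
  exact ⟨fun k => (p k).1, hp₀, fun k => hstep k (p k)⟩

theorem IsLearned.sample_le_bound {N : ℕ} {ws : Fin N → Fin nx → ℝ} {w : ℕ → Fin nx → ℝ}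
    {p : ℕ → ShapeParam nx nv} (hp : IsLearned V ws w p) (s : Fin N) (k : ℕ) :
    V *ᵥ ws s ≤ (p k).bound V := by
  induction k with
  | zero => exact hp.1.1.2 s
  | succ k ih => exact ih.trans (hp.2 k).1.2.1

/-- Points outside a learned set exceed all offline samples in one of the facet directions. -/
theorem IsLearned.compl_toSet_subset {N : ℕ} {ws : Fin N → Fin nx → ℝ} {w : ℕ → Fin nx → ℝ}
    {p : ℕ → ShapeParam nx nv} (hp : IsLearned V ws w p) (k : ℕ) :
    ((p k).toSet V)ᶜ ⊆ {x | ∃ i, ∀ s, (V *ᵥ ws s) i < (V *ᵥ x) i} := by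
  intro x hx
  have h : ¬ V *ᵥ x ≤ (p k).bound V := fun h => hx (mem_toSet_of_le_bound h)
  rw [Pi.le_def] at h
  push Not at h
  obtain ⟨i, hi⟩ := h
  exact ⟨i, fun s => (hp.sample_le_bound s k i).trans_lt hi⟩

end ShapeParam

/-! ### The probabilistic guarantee. -/

theorem theorem2 {Ω : Type*} [MeasurableSpace Ω] (P : Measure Ω) [IsProbabilityMeasure P]
    (nx nv : ℕ) (V : Matrix (Fin nv) (Fin nx) ℝ)
    -- the base polytope is compact
    (hW : IsCompact (basePolytope V))
    -- the distribution of the disturbance, with support `Wtrue` contained in the base polytope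
    (μ : Measure (Fin nx → ℝ)) [IsProbabilityMeasure μ] (Wtrue : Set (Fin nx → ℝ))
    (hsupp : μ.support = Wtrue) (hsub : Wtrue ⊆ basePolytope V)
    -- i.i.d. offline samples
    (N : ℕ) (ws : Fin N → Ω → Fin nx → ℝ)
    (hws : ∀ s, HasLaw (ws s) μ P) (hws_indep : iIndepFun ws P)
    -- i.i.d. online disturbances
    (w : ℕ → Ω → Fin nx → ℝ)
    (hw : ∀ k, HasLaw (w k) μ P) (hw_indep : iIndepFun w P)
    (ε δ : ℝ) (hε : ε ∈ Set.Ioo (0 : ℝ) 1) (hδ : δ ∈ Set.Ioo (0 : ℝ) 1)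
    (hN : (1 / ε) * (Real.exp 1 / (Real.exp 1 - 1)) * ((nx : ℝ) + (nv : ℝ) + Real.log (1 / δ))
      ≤ (N : ℝ)) :
    -- on an event of probability at least `1 - δ` the learned sets exist and, however ties between
    -- optimisers are broken, all of them have violation probability at most `ε`
    ∃ A : Set Ω, MeasurableSet A ∧ 1 - δ ≤ P.real A ∧ ∀ ω ∈ A,
      (∃ p : ℕ → ShapeParam nx nv,
        ShapeParam.IsLearned V (fun s => ws s ω) (fun k => w k ω) p) ∧
      ∀ p : ℕ → ShapeParam nx nv,
        ShapeParam.IsLearned V (fun s => ws s ω) (fun k => w k ω) p →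
        ∀ k : ℕ, μ.real {x | x ∈ Wtrue ∧ x ∉ (p k).toSet V} ≤ ε := by
  obtain ⟨hε0, hε1⟩ := hε
  obtain ⟨hδ0, hδ1⟩ := hδ
  have he : 1 < Real.exp 1 := by simp
  have hlog : 0 < Real.log (1 / δ) := Real.log_pos (one_lt_one_div hδ0 hδ1)
  have hNε : (nx : ℝ) + nv + Real.log (1 / δ) ≤ N * ε * (1 - (Real.exp 1)⁻¹) := by
    have h1 : 0 < ε * (1 - (Real.exp 1)⁻¹) := mul_pos hε0 (sub_pos.2 (inv_lt_one_of_one_lt₀ he))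
    have h2 := mul_le_mul_of_nonneg_right hN h1.le
    have h3 : Real.exp 1 - 1 ≠ 0 := (sub_pos.2 he).ne'
    calc _ = (1 / ε) * (Real.exp 1 / (Real.exp 1 - 1)) * ((nx : ℝ) + nv + Real.log (1 / δ)) *
          (ε * (1 - (Real.exp 1)⁻¹)) := by field_simp
      _ ≤ _ := by linarith
  have hcard : (nv : ℝ) < N * ε := by
    have h0 : (0 : ℝ) ≤ N * ε := by positivity
    have h1 : N * ε * (1 - (Real.exp 1)⁻¹) ≤ N * ε :=
      mul_le_of_le_one_right h0 (by linarith [inv_pos.2 (Real.exp_pos 1)])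
    have h2 : (0 : ℝ) ≤ nx := nx.cast_nonneg
    linarith
  have hf : ∀ i, Measurable fun x : Fin nx → ℝ => (V *ᵥ x) i := fun i =>
    Continuous.measurable (by fun_prop)
  set B : Set (Fin N → Fin nx → ℝ) :=
    {x | ε < μ.real {y | ∃ i, ∀ j, (V *ᵥ x j) i < (V *ᵥ y) i}} with hB
  have hBδ : Measure.pi (fun _ : Fin N => μ) B ≤ ENNReal.ofReal δ := by
    refine (pi_measure_lt_measure_exceeding_le_exp (J := Fin N) hf μ ⟨hε0, hε1⟩
      (by simpa using hcard)).trans (ENNReal.ofReal_le_ofReal ?_)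
    rw [← Real.le_log_iff_exp_le hδ0]
    rw [one_div, Real.log_inv] at hNε
    simp only [Fintype.card_fin]
    -- Only `nv` maxima matter; the term `nx` is slack.
    have h2 : (0 : ℝ) ≤ nx := nx.cast_nonneg
    linarith
  have hmap : P.map (fun ω s => ws s ω) = Measure.pi fun _ : Fin N => μ := by
    rw [(iIndepFun_iff_map_fun_eq_pi_map fun s => (hws s).aemeasurable).1 hws_indep]
    simp only [(hws _).map_eq]
  have hPB : P ((fun ω s => ws s ω) ⁻¹' B) ≤ ENNReal.ofReal δ := by
    refine (Measure.le_map_apply (aemeasurable_pi_lambda _ fun s => (hws s).aemeasurable) B).trans ?_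
    rwa [hmap]
  have hmem : ∀ X : Ω → Fin nx → ℝ, HasLaw X μ P → ∀ᵐ ω ∂P, X ω ∈ basePolytope V := by
    intro X hX
    have h : ∀ᵐ x ∂μ, x ∈ basePolytope V := by
      filter_upwards [Measure.support_mem_ae (μ := μ)] with x hx
      exact hsub (hsupp ▸ hx)
    rw [← hX.map_eq] at h
    exact ae_of_ae_map hX.aemeasurable h
  have hae : ∀ᵐ ω ∂P, (∀ s, ws s ω ∈ basePolytope V) ∧ ∀ k, w k ω ∈ basePolytope V :=
    (ae_all_iff.2 fun s => hmem _ (hws s)).and (ae_all_iff.2 fun k => hmem _ (hw k))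
  set E : Set Ω := (fun ω s => ws s ω) ⁻¹' B ∪
    {ω | ¬((∀ s, ws s ω ∈ basePolytope V) ∧ ∀ k, w k ω ∈ basePolytope V)}
  have hE : P E ≤ ENNReal.ofReal δ := by
    refine (measure_union_le _ _).trans ?_
    rw [ae_iff.1 hae, add_zero]
    exact hPB
  -- The measurable hull avoids having to prove `E` measurable.
  refine ⟨(toMeasurable P E)ᶜ, (measurableSet_toMeasurable P E).compl, ?_, fun ω hω => ?_⟩
  · rw [probReal_compl_eq_one_sub (measurableSet_toMeasurable P E), measureReal_def,
      measure_toMeasurable]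
    exact sub_le_sub_left (ENNReal.toReal_le_of_le_ofReal hδ0.le hE) 1
  · have hωE : ω ∉ E := fun h => hω (subset_toMeasurable P E h)
    simp only [E, Set.mem_union, not_or, Set.mem_ofPred_eq, not_not] at hωE
    refine ⟨ShapeParam.exists_isLearned hW hωE.2.1 hωE.2.2, fun p hp k => ?_⟩
    refine (measureReal_mono ?_).trans (not_lt.1 hωE.1)
    exact fun x hx => hp.compl_toSet_subset k hx.2
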